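/- Let $(X,d)$ be a metric space. For $A\subseteq X$ let $\operatorname{diam}A=\sup\{d(a,a'):a,a'\in A\}\in[0,\infty]$ (with $\operatorname{diam}\emptyset=0$), and let $$L^*(A)=\sup_{\delta>0}\ \inf\Big\{\sum_{i\in\mathbb N}\operatorname{diam}(U_i)\ :\ A\subseteq\bigcup_{i\in\mathbb N}U_i,\ U_i\subseteq X,\ \operatorname{diam}(U_i)\le\delta\text{ for all }i\Big\}\in[0,\infty]$$ be its outer linear measure (one-dimensional Hausdorff outer measure). A set $A\subseteq X$ \emph{hits} a collection $\mathscr U$ of subsets of $X$ if $A\cap U\neq\emptyset$ for all $U\in\mathscr U$. For $A,B\subseteq X$ let $e(A,B)=\sup_{a\in A}\inf_{b\in B}d(a,b)\in[0,\infty]$, where $\sup\emptyset=0$ and $\inf\emptyset=\infty$. The empty set is counted as connected. \textbf{Main statement.} Let $A\subseteq X$. (1) If $L^*(A)<\infty$, then for every $\varepsilon>0$ there is a finite collection $\mathscr U$ of open subsets of $X$ hit by $A$ such that every connected $B\subseteq X$ that hits $\mathscr U$ satisfies $L^*(A)<L^*(B)+\varepsilon$. (2) If $L^*(A)=\infty$,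 then for every $M>0$ there is a finite collection $\mathscr U$ of open subsets of $X$ hit by $A$ such that every connected $B\subseteq X$ that hits $\mathscr U$ satisfies $L^*(B)>M$. Moreover, the following hold. (3) (Lower semicontinuity.) Equip the power set of $X$ with the lower Vietoris topology, generated by the sets $\{S\subseteq X: S\cap U\neq\emptyset\}$ with $U\subseteq X$ open. Then $L^*$ is lower semicontinuous on the subspace of connected subsets of $X$. (4) (Gołąb.) If $A\subseteq X$ and $(A_n)_{n\in\mathbb N}$ is a sequence of connected subsets of $X$ with $\lim_{n\to\infty}e(A,A_n)=0$, then $L^*(A)\le\liminf_{n\to\infty}L^*(A_n)$. (5) (Frink.) Let $A\subseteq X$. If $L^*(A)<\infty$, then for every $\varepsilon>0$ there is $\delta>0$ such that every connected $B\subseteq X$ with $e(A,B)<\delta$ satisfies $L^*(A)<L^*(B)+\varepsilon$. If $L^*(A)=\infty$, then for every $M>0$ there is $\delta>0$ such that every connected $B\subseteq X$ with $e(A,B)<\delta$ satisfies $L^*(B)>M$. (6) (Bognár.) Let $(A_\lambda)_{\lambda\in\Lambda}$ be a net of connected subsets of $X$, indexed by a nonempty directed set $(\Lambda,\preccurlyeq)$,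 and let $\operatorname{Li}A_\lambda$ be its lower limit, the set of all $x\in X$ such that for every $\varepsilon>0$ there is $\lambda_0\in\Lambda$ with $A_\lambda\cap B(x,\varepsilon)\neq\emptyset$ for all $\lambda\succcurlyeq\lambda_0$, where $B(x,\varepsilon)$ is the open ball. Then $L^*(\operatorname{Li}A_\lambda)\le\liminf_\lambda L^*(A_\lambda)$. (7) (Fremlin.) Let $A\subseteq X$ and let $\alpha\ge 0$ be a real number. If for every finite collection $\mathscr U$ of open subsets of $X$ hit by $A$ there is a connected $C\subseteq X$ that hits $\mathscr U$ and satisfies $L^*(C)\le\alpha$, then $L^*(A)\le\alpha$. -/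

import Mathlib

open Filter Topology
open scoped ENNReal NNReal MeasureTheory

namespace Golab

noncomputable section

/-- `L*_δ(A)`: the infimum of `∑ diam (U i)` over all covers of `A` by a sequence of sets of
diameter at most `δ`. Diameters take values in `[0, ∞]`, and `diam ∅ = 0`. -/
def outerLinearPre {X : Type*} [MetricSpace X] (δ : ℝ) (A : Set X) : ℝ≥0∞ :=
  ⨅ (U : ℕ → Set X) (_ : A ⊆ ⋃ i, U i) (_ : ∀ i, Metric.ediam (U i) ≤ ENNReal.ofReal δ),
    ∑' i, Metric.ediam (U i)

/-- The outer linear measure `L*(A) = sup_{δ > 0} L*_δ(A)` of an arbitrary subset of a metric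
space (the one-dimensional Hausdorff outer measure). -/
def outerLinear {X : Type*} [MetricSpace X] (A : Set X) : ℝ≥0∞ :=
  ⨆ (δ : ℝ) (_ : 0 < δ), outerLinearPre δ A

/-- `L*` is Mathlib's one-dimensional Hausdorff measure, evaluated on arbitrary sets. -/
theorem outerLinear_eq_hausdorffMeasure {X : Type*} [MetricSpace X] [MeasurableSpace X]
    [BorelSpace X] (A : Set X) : outerLinear A = μH[1] A := by
  have key : ∀ s : Set X, (⨆ _ : s.Nonempty, Metric.ediam s ^ (1 : ℝ)) = Metric.ediam s := by
    intro s
    rcases s.eq_empty_or_nonempty with rfl | h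
    · simp
    · simp [h]
  rw [MeasureTheory.Measure.hausdorffMeasure_apply]
  simp only [key]
  unfold outerLinear outerLinearPre
  apply le_antisymm
  · refine iSup₂_le fun δ hδ => ?_
    exact le_iSup₂_of_le (ENNReal.ofReal δ) (ENNReal.ofReal_pos.2 hδ) le_rfl
  · refine iSup₂_le fun r hr => ?_
    obtain ⟨δ, hδ0, hδ⟩ : ∃ δ : ℝ, 0 < δ ∧ ENNReal.ofReal δ ≤ r := by
      rcases eq_or_ne r ∞ with rfl | h
      · exact ⟨1, one_pos, le_top⟩
      · exact ⟨r.toReal, ENNReal.toReal_pos hr.ne' h, ENNReal.ofReal_toReal_le⟩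
    refine le_iSup₂_of_le δ hδ0 ?_
    refine le_iInf fun U => le_iInf fun hU => le_iInf fun hd => ?_
    exact iInf_le_of_le U (iInf_le_of_le hU (iInf_le_of_le (fun i => (hd i).trans hδ) le_rfl))

/-- A set hits a collection of sets if it meets every member of the collection. -/
def Hits {X : Type*} (A : Set X) (𝓤 : Set (Set X)) : Prop :=
  ∀ U ∈ 𝓤, (A ∩ U).Nonempty

/-- The excess `e(A, B) = sup_{a ∈ A} d(a, B)` of `A` over `B`, with values in `[0, ∞]`;
`d(a, ∅) = ∞` and `e(∅, B) = 0`. -/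
def excess {X : Type*} [MetricSpace X] (A B : Set X) : ℝ≥0∞ :=
  ⨆ a ∈ A, Metric.infEDist a B

/-- The (Painlevé–Kuratowski) lower limit of a net of sets: the points each of whose
neighbourhoods is eventually met by the net. -/
def lowerLimit {X : Type*} [MetricSpace X] {Λ : Type*} [Preorder Λ] (A : Λ → Set X) : Set X :=
  {x | ∀ ε : ℝ, 0 < ε → ∃ l₀ : Λ, ∀ l, l₀ ≤ l → (A l ∩ Metric.ball x ε).Nonempty}

/-- The lower Vietoris topology on the set of all subsets of `X`, generated by the sets
`{S | S ∩ U ≠ ∅}` with `U` open. -/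
@[reducible]
def lowerVietoris (X : Type*) [TopologicalSpace X] : TopologicalSpace (Set X) :=
  TopologicalSpace.generateFrom {𝓢 | ∃ U : Set X, IsOpen U ∧ 𝓢 = {S | (S ∩ U).Nonempty}}

end

end Golab

/-!
Cover a connected set `B` by open sets of small diameter whose total diameter exceeds `L*(B)` only
slightly. By connectedness any two members of the cover are joined by a chain, so greedily one can
select disjoint *blocks* of members, each with diameter at most its total weight `∑ diam`, such that
the `j`-th block (counting from `0`) has weight at least `c / j` as long as some point of `B` is
further than `c / j` from the earlier blocks. The harmonic series diverges, so this stops after a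
number `m` of steps bounded independently of `B`; then the `c / m`-neighbourhoods of the `m` blocks
cover `B` and cost only `m * (2 * c / m)` more than the blocks. Hence every finite set near `B` has
a cover by a bounded number of small sets of total diameter at most `L*(B) + κ`. An ultrafilter
limit over the finite subsets of `A` turns covers of a bounded number of sets into such a cover of
`A`. So, if `L*(A)` exceeds `a`, some finite `F ⊆ A` already prevents `L*(B) ≤ a` for all connected
`B` that meet small balls around the points of `F`.
-/

namespace Golab

section Blocks

variable {X ι : Type*} {B : Set X} {U : ι → Set X}

theorem reflTransGen_inter_nonempty_of_isPreconnected [TopologicalSpace X] (hB : IsPreconnected B)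
    (hU : ∀ i, IsOpen (U i)) (hBU : B ⊆ ⋃ i, U i) {i j : ι} (hi : (B ∩ U i).Nonempty)
    (hj : (B ∩ U j).Nonempty) :
    Relation.ReflTransGen (fun a b => (U a ∩ U b).Nonempty) i j := by
  by_contra hij
  let R := {k | Relation.ReflTransGen (fun a b => (U a ∩ U b).Nonempty) i k}
  have hcover : B ⊆ (⋃ k ∈ R, U k) ∪ ⋃ k ∈ Rᶜ, U k := by
    rwa [← Set.biUnion_union, Set.union_compl_self, Set.biUnion_univ]
  have meets {s : Set ι} {k : ι} (hk : k ∈ s) (h : (B ∩ U k).Nonempty) :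
      (B ∩ ⋃ k ∈ s, U k).Nonempty :=
    h.mono (Set.inter_subset_inter_right _ (Set.subset_biUnion_of_mem hk))
  obtain ⟨x, -, hxR, hxRc⟩ := hB _ _ (isOpen_biUnion fun k _ => hU k)
    (isOpen_biUnion fun k _ => hU k) hcover (meets (s := R) .refl hi) (meets (s := Rᶜ) hij hj)
  obtain ⟨a, ha, hxa⟩ := Set.mem_iUnion₂.1 hxR
  obtain ⟨b, hb, hxb⟩ := Set.mem_iUnion₂.1 hxRc
  exact hb (Relation.ReflTransGen.tail ha ⟨x, hxa, hxb⟩)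

variable [PseudoEMetricSpace X] {r : ℝ≥0∞} {c t : ℝ≥0}

/-- A block of a family `U`: a finite set of indices whose members have a union of diameter at most
their total weight `∑ diam (U i)`, this weight being at most `r`. -/
structure IsBlock (U : ι → Set X) (r : ℝ≥0∞) (G : Finset ι) : Prop where
  ediam_biUnion_le : Metric.ediam (⋃ i ∈ G, U i) ≤ ∑ i ∈ G, Metric.ediam (U i)
  sum_ediam_le : ∑ i ∈ G, Metric.ediam (U i) ≤ r

theorem IsBlock.singleton {i : ι} (h : Metric.ediam (U i) ≤ r) : IsBlock U r {i} :=
  ⟨by simp, by simpa using h⟩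

theorem IsBlock.cons {G : Finset ι} (hG : IsBlock U r G) {j k : ι} (hj : j ∈ G) (hk : k ∉ G)
    (hjk : (U j ∩ U k).Nonempty)
    (hr : Metric.ediam (U k) + ∑ i ∈ G, Metric.ediam (U i) ≤ r) :
    IsBlock U r (G.cons k hk) where
  sum_ediam_le := by rwa [Finset.sum_cons]
  ediam_biUnion_le := by
    obtain ⟨x, hxj, hxk⟩ := hjk
    simp only [Finset.mem_cons, Set.iUnion_iUnion_eq_or_left, Finset.sum_cons]
    exact (Metric.ediam_union_le ⟨x, hxk, Set.mem_biUnion hj hxj⟩).trans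
      (add_le_add_right hG.ediam_biUnion_le _)

/-- The block is grown along the chain; it need not exceed weight `2 * c` because each further
member adds at most `c`. -/
theorem exists_isBlock_of_reflTransGen (hUc : ∀ i, Metric.ediam (U i) ≤ c) {F : Set ι} {i j : ι}
    (hi : i ∉ F) (hij : Relation.ReflTransGen (fun a b => (U a ∩ U b).Nonempty) i j) :
    ∃ G : Finset ι, i ∈ G ∧ Disjoint (G : Set ι) F ∧ IsBlock U (2 * c) G ∧
      (c ≤ ∑ k ∈ G, Metric.ediam (U k) ∨ j ∈ G ∨ ∃ a ∈ G, ∃ b ∈ F, (U a ∩ U b).Nonempty) := by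
  induction hij with
  | refl =>
    exact ⟨{i}, by simp, by simpa, .singleton ((hUc i).trans (le_mul_of_one_le_left' one_le_two)),
      by simp⟩
  | @tail j k _ hjk ih =>
    obtain ⟨G, hiG, hGF, hG, heavy | hjG | touch⟩ := ih
    · exact ⟨G, hiG, hGF, hG, .inl heavy⟩
    · by_cases hkG : k ∈ G
      · exact ⟨G, hiG, hGF, hG, .inr (.inl hkG)⟩
      by_cases hkF : k ∈ F
      · exact ⟨G, hiG, hGF, hG, .inr (.inr ⟨j, hjG, k, hkF, hjk⟩)⟩
      by_cases hs : Metric.ediam (U k) + ∑ a ∈ G, Metric.ediam (U a) ≤ 2 * c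
      · exact ⟨G.cons k hkG, by simp [hiG], by simp [Set.disjoint_insert_left, hkF, hGF],
          hG.cons hjG hkG hjk hs, by simp⟩
      · refine ⟨G, hiG, hGF, hG, .inl ?_⟩
        rw [not_le, two_mul] at hs
        have hlt := hs.trans_le (add_le_add_left (hUc k) _)
        exact ((ENNReal.add_lt_add_iff_left ENNReal.coe_ne_top).1 hlt).le
    · exact ⟨G, hiG, hGF, hG, .inr (.inr touch)⟩

theorem exists_isBlock_of_forall_lt_edist (hB : IsPreconnected B) (hU : ∀ i, IsOpen (U i))
    (hBU : B ⊆ ⋃ i, U i) (hUc : ∀ i, Metric.ediam (U i) ≤ c) (htc : t ≤ c) {F : Set ι}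
    (hF : ∃ j ∈ F, (B ∩ U j).Nonempty) {y : X} (hy : y ∈ B)
    (hyF : ∀ j ∈ F, ∀ z ∈ U j, t < edist y z) :
    ∃ G : Finset ι, G.Nonempty ∧ Disjoint (G : Set ι) F ∧ IsBlock U (2 * c) G ∧
      t ≤ ∑ k ∈ G, Metric.ediam (U k) := by
  obtain ⟨i, hyi⟩ := Set.mem_iUnion.1 (hBU hy)
  obtain ⟨j, hjF, hj⟩ := hF
  have hiF : i ∉ F := fun h => absurd (hyF i h y hyi) (by simp)
  obtain ⟨G, hiG, hGF, hG, heavy | hjG | ⟨a, haG, b, hbF, z, hza, hzb⟩⟩ :=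
    exists_isBlock_of_reflTransGen hUc hiF
      (reflTransGen_inter_nonempty_of_isPreconnected hB hU hBU ⟨y, hy, hyi⟩ hj)
  all_goals refine ⟨G, ⟨i, hiG⟩, hGF, hG, ?_⟩
  · exact (ENNReal.coe_le_coe.2 htc).trans heavy
  · exact absurd hjF (Set.disjoint_left.1 hGF hjG)
  · calc (t : ℝ≥0∞) ≤ edist y z := (hyF b hbF z hzb).le
      _ ≤ Metric.ediam (⋃ k ∈ G, U k) :=
        Metric.edist_le_ediam_of_mem (Set.mem_biUnion hiG hyi) (Set.mem_biUnion haG hza)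
      _ ≤ ∑ k ∈ G, Metric.ediam (U k) := hG.ediam_biUnion_le

/-- A finite family of pairwise disjoint blocks of weight at most `r`, as selected by the greedy
algorithm. -/
structure IsBlockFamily (U : ι → Set X) (r : ℝ≥0∞) (𝓖 : Finset (Finset ι)) : Prop where
  isBlock : ∀ G ∈ 𝓖, IsBlock U r G
  pairwiseDisjoint : (𝓖 : Set (Finset ι)).PairwiseDisjoint id

theorem IsBlockFamily.sum_sum_ediam_le_tsum {𝓖 : Finset (Finset ι)} (h𝓖 : IsBlockFamily U r 𝓖) :
    ∑ G ∈ 𝓖, ∑ i ∈ G, Metric.ediam (U i) ≤ ∑' i, Metric.ediam (U i) := by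
  classical
  exact (Finset.sum_biUnion h𝓖.pairwiseDisjoint).symm.trans_le (ENNReal.sum_le_tsum _)

theorem IsBlockFamily.exists_cons (hB : IsPreconnected B) (hU : ∀ i, IsOpen (U i))
    (hBU : B ⊆ ⋃ i, U i) (hUc : ∀ i, Metric.ediam (U i) ≤ c) (htc : t ≤ c)
    {𝓖 : Finset (Finset ι)} (h𝓖 : IsBlockFamily U (2 * c) 𝓖)
    (hmeet : ∃ G ∈ 𝓖, ∃ i ∈ G, (B ∩ U i).Nonempty)
    (hfar : ¬ Metric.IsCover t B (⋃ G ∈ 𝓖, ⋃ i ∈ G, U i)) :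
    ∃ (H : Finset ι) (hH : H ∉ 𝓖), IsBlockFamily U (2 * c) (𝓖.cons H hH) ∧
      t ≤ ∑ i ∈ H, Metric.ediam (U i) := by
  obtain ⟨y, hyB, hy⟩ : ∃ y ∈ B, ∀ z ∈ ⋃ G ∈ 𝓖, ⋃ i ∈ G, U i, t < edist y z := by
    simpa [Metric.IsCover, SetRel.IsCover] using hfar
  obtain ⟨G₀, hG₀, i₀, hi₀, hBi₀⟩ := hmeet
  obtain ⟨H, hHne, hdisj, hH, htH⟩ := exists_isBlock_of_forall_lt_edist hB hU hBU hUc htc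
    (F := {i | ∃ G ∈ 𝓖, i ∈ G}) ⟨i₀, ⟨G₀, hG₀, hi₀⟩, hBi₀⟩ hyB
    fun j ⟨G, hG, hj⟩ z hz => hy z (Set.mem_biUnion hG (Set.mem_biUnion hj hz))
  have hdisjG : ∀ G ∈ 𝓖, Disjoint H G := fun G hG => Finset.disjoint_left.2 fun i hiH hiG =>
    Set.disjoint_left.1 hdisj hiH ⟨G, hG, hiG⟩
  have hH𝓖 : H ∉ 𝓖 := fun h => hHne.ne_empty (disjoint_self.1 (hdisjG H h))
  refine ⟨H, hH𝓖, ⟨by simpa [hH] using h𝓖.isBlock, ?_⟩, htH⟩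
  rw [Finset.coe_cons]
  exact h𝓖.pairwiseDisjoint.insert fun G hG _ => hdisjG G hG

theorem exists_isBlockFamily_isCover_or_sum_le (hB : IsPreconnected B) (hU : ∀ i, IsOpen (U i))
    (hBU : B ⊆ ⋃ i, U i) (hUc : ∀ i, Metric.ediam (U i) ≤ c) {t : ℕ → ℝ≥0} (ht0 : t 0 = 0)
    (htc : ∀ j, t j ≤ c) (n : ℕ) :
    (∃ 𝓖, IsBlockFamily U (2 * c) 𝓖 ∧ 𝓖.card ≤ n ∧
      Metric.IsCover (t 𝓖.card) B (⋃ G ∈ 𝓖, ⋃ i ∈ G, U i)) ∨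
    ∃ 𝓖, IsBlockFamily U (2 * c) 𝓖 ∧ 𝓖.card = n + 1 ∧ (∃ G ∈ 𝓖, ∃ i ∈ G, (B ∩ U i).Nonempty) ∧
      ∑ j ∈ Finset.range (n + 1), (t j : ℝ≥0∞) ≤ ∑ G ∈ 𝓖, ∑ i ∈ G, Metric.ediam (U i) := by
  induction n with
  | zero =>
    rcases B.eq_empty_or_nonempty with rfl | ⟨x, hx⟩
    · exact .inl ⟨∅, ⟨by simp, by simp⟩, by simp, .empty⟩
    · obtain ⟨i, hi⟩ := Set.mem_iUnion.1 (hBU hx)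
      have hblock : IsBlock U (2 * c) {i} :=
        .singleton ((hUc i).trans (le_mul_of_one_le_left' one_le_two))
      exact .inr ⟨{{i}}, ⟨by simpa using hblock, by simp⟩, by simp,
        ⟨{i}, by simp, i, by simp, x, hx, hi⟩, by simp [ht0]⟩
  | succ n ih =>
    obtain ⟨𝓖, h𝓖, hcard, hcov⟩ | ⟨𝓖, h𝓖, hcard, hmeet, hsum⟩ := ih
    · exact .inl ⟨𝓖, h𝓖, hcard.trans n.le_succ, hcov⟩
    by_cases hcov : Metric.IsCover (t 𝓖.card) B (⋃ G ∈ 𝓖, ⋃ i ∈ G, U i)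
    · exact .inl ⟨𝓖, h𝓖, hcard.le, hcov⟩
    · obtain ⟨H, hH, hfam, htH⟩ := h𝓖.exists_cons hB hU hBU hUc (htc _) hmeet hcov
      refine .inr ⟨𝓖.cons H hH, hfam, by simp [hcard], ?_, ?_⟩
      · obtain ⟨G, hG, hmeetG⟩ := hmeet
        exact ⟨G, Finset.mem_cons_of_mem hG, hmeetG⟩
      · rw [Finset.sum_range_succ, Finset.sum_cons, add_comm, ← hcard]
        rw [← hcard] at hsum
        exact add_le_add htH hsum

theorem exists_isBlockFamily_isCover (hB : IsPreconnected B) (hU : ∀ i, IsOpen (U i))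
    (hBU : B ⊆ ⋃ i, U i) (hUc : ∀ i, Metric.ediam (U i) ≤ c) {t : ℕ → ℝ≥0} (ht0 : t 0 = 0)
    (htc : ∀ j, t j ≤ c) {K : ℕ}
    (hK : ∑' i, Metric.ediam (U i) < ∑ j ∈ Finset.range K, (t j : ℝ≥0∞)) :
    ∃ 𝓖, IsBlockFamily U (2 * c) 𝓖 ∧ 𝓖.card < K ∧
      Metric.IsCover (t 𝓖.card) B (⋃ G ∈ 𝓖, ⋃ i ∈ G, U i) := by
  obtain _ | n := K
  · simp at hK
  obtain ⟨𝓖, h𝓖, hcard, hcov⟩ | ⟨𝓖, h𝓖, -, -, hsum⟩ :=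
    exists_isBlockFamily_isCover_or_sum_le hB hU hBU hUc ht0 htc n
  · exact ⟨𝓖, h𝓖, Nat.lt_succ_of_le hcard, hcov⟩
  · exact absurd (hsum.trans h𝓖.sum_sum_ediam_le_tsum) hK.not_ge

end Blocks

section DiamCover

variable {X ι κ : Type*} [PseudoEMetricSpace X] {δ s : ℝ≥0∞} {S : ι → Set X} {A : Set X}

/-- A cover of `A` by sets of diameter at most `δ` and of total diameter at most `s`, as in the
definition of `L*_δ(A)` but indexed by an arbitrary type. -/
structure IsDiamCover (δ s : ℝ≥0∞) (S : ι → Set X) (A : Set X) : Prop where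
  subset_iUnion : A ⊆ ⋃ i, S i
  ediam_le : ∀ i, Metric.ediam (S i) ≤ δ
  tsum_ediam_le : ∑' i, Metric.ediam (S i) ≤ s

theorem IsDiamCover.mono {δ' s' : ℝ≥0∞} (h : IsDiamCover δ s S A) (hδ : δ ≤ δ') (hs : s ≤ s') :
    IsDiamCover δ' s' S A :=
  ⟨h.subset_iUnion, fun i => (h.ediam_le i).trans hδ, h.tsum_ediam_le.trans hs⟩

theorem IsDiamCover.extend (h : IsDiamCover δ s S A) {f : ι → κ} (hf : f.Injective) :
    IsDiamCover δ s (Function.extend f S ⊥) A := by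
  have hdiam : (fun k => Metric.ediam (Function.extend f S ⊥ k)) =
      Function.extend f (fun i => Metric.ediam (S i)) 0 := by
    ext k
    simp [Function.apply_extend Metric.ediam, Function.comp_def, Pi.zero_def]
  refine ⟨h.subset_iUnion.trans_eq (iSup_extend_bot hf S).symm, fun k => ?_, ?_⟩
  · rw [congrFun hdiam k]
    by_cases hk : ∃ i, f i = k
    · obtain ⟨i, rfl⟩ := hk
      rw [hf.extend_apply]
      exact h.ediam_le i
    · simp [Function.extend_apply' _ _ _ hk]
  · rw [hdiam, tsum_extend_zero hf]
    exact h.tsum_ediam_le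

theorem IsDiamCover.exists_isOpen [Countable ι] (h : IsDiamCover δ s S A) {ε : ℝ≥0} (hε : 0 < ε) :
    ∃ U : ι → Set X, (∀ i, IsOpen (U i)) ∧ IsDiamCover (δ + ε) (s + ε) U A := by
  obtain ⟨r, hr, hsum⟩ := ENNReal.exists_pos_sum_of_countable
    (ENNReal.coe_ne_zero.2 (half_pos hε).ne') ι
  have htwo : 2 * ∑' i, (r i : ℝ≥0∞) ≤ ε := by
    calc 2 * ∑' i, (r i : ℝ≥0∞) ≤ 2 * (ε / 2 : ℝ≥0) := by gcongr
      _ = ε := by exact_mod_cast mul_div_cancel₀ ε two_ne_zero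
  have hdiam (i : ι) : Metric.ediam (Metric.thickening (r i) (S i)) ≤
      Metric.ediam (S i) + 2 * r i := Metric.ediam_thickening_le (r i)
  refine ⟨fun i => Metric.thickening (r i) (S i), fun i => Metric.isOpen_thickening,
    h.subset_iUnion.trans (Set.iUnion_mono fun i => Metric.self_subset_thickening (hr i) _),
    fun i => (hdiam i).trans (add_le_add (h.ediam_le i) ?_), ?_⟩
  · exact (mul_le_mul_right (ENNReal.le_tsum i) 2).trans htwo
  · calc ∑' i, Metric.ediam (Metric.thickening (r i) (S i))
        ≤ ∑' i, (Metric.ediam (S i) + 2 * r i) := ENNReal.tsum_le_tsum hdiam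
      _ = ∑' i, Metric.ediam (S i) + 2 * ∑' i, (r i : ℝ≥0∞) := by
        rw [ENNReal.tsum_add, ENNReal.tsum_mul_left]
      _ ≤ s + ε := add_le_add h.tsum_ediam_le htwo

theorem ediam_liminf_le {α : Type*} (l : Filter α) (S : α → Set X) :
    Metric.ediam (liminf S l) ≤ liminf (fun a => Metric.ediam (S a)) l := by
  refine Metric.ediam_le fun x hx y hy => le_liminf_of_le (by isBoundedDefault) ?_
  filter_upwards [mem_liminf_iff_eventually_mem.1 hx, mem_liminf_iff_eventually_mem.1 hy]
    with a hxa hya using Metric.edist_le_ediam_of_mem hxa hya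

theorem IsDiamCover.liminf_ultrafilter [Finite ι] {α : Type*} (u : Ultrafilter α)
    {S : α → ι → Set X} {F : α → Set X} (h : ∀ a, IsDiamCover δ s (S a) (F a)) :
    IsDiamCover δ s (fun i => liminf (fun a => S a i) u) (liminf F u) := by
  have := Fintype.ofFinite ι
  have hlim (i : ι) : Tendsto (fun a => Metric.ediam (S a i)) u
      (𝓝 (liminf (fun a => Metric.ediam (S a i)) u)) := by
    have hu := (u.map fun a => Metric.ediam (S a i)).le_nhds_lim
    exact (Tendsto.liminf_eq hu).symm ▸ hu
  refine ⟨fun x hx => ?_, fun i => (ediam_liminf_le _ _).trans ?_, ?_⟩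
  · have hmem : ∀ᶠ a in u, ∃ i, x ∈ S a i := (mem_liminf_iff_eventually_mem.1 hx).mono
      fun a hxa => Set.mem_iUnion.1 ((h a).subset_iUnion hxa)
    obtain ⟨i, hi⟩ := Ultrafilter.eventually_exists_iff.1 hmem
    exact Set.mem_iUnion.2 ⟨i, mem_liminf_iff_eventually_mem.2 hi⟩
  · exact le_of_tendsto (hlim i) (.of_forall fun a => (h a).ediam_le i)
  · rw [tsum_fintype]
    refine (Finset.sum_le_sum fun i _ => ediam_liminf_le _ _).trans
      (le_of_tendsto (tendsto_finsetSum _ fun i _ => hlim i) (.of_forall fun a => ?_))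
    rw [← tsum_fintype (L := .unconditional ι)]
    exact (h a).tsum_ediam_le

theorem exists_isDiamCover_of_forall_finset [Finite ι]
    (h : ∀ F : Finset X, (F : Set X) ⊆ A → ∃ S : ι → Set X, IsDiamCover δ s S F) :
    ∃ S : ι → Set X, IsDiamCover δ s S A := by
  choose S hS using fun F : Finset A =>
    h (F.map (.subtype _)) (by simpa [Set.subset_def] using fun x hx _ => hx)
  let u : Ultrafilter (Finset A) := .of atTop
  have hA : A ⊆ liminf (fun F : Finset A => ((F.map (.subtype _) : Finset X) : Set X)) u := by
    refine fun x hx => mem_liminf_iff_eventually_mem.2 ?_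
    filter_upwards [Ultrafilter.of_le atTop (eventually_ge_atTop {⟨x, hx⟩})] with F hF
    simpa [hx] using hF
  have hcov := IsDiamCover.liminf_ultrafilter u hS
  exact ⟨_, hA.trans hcov.subset_iUnion, hcov.ediam_le, hcov.tsum_ediam_le⟩

end DiamCover

section NearConnected

variable {X ι : Type*} [PseudoEMetricSpace X] {B F : Set X} {U : ι → Set X}

theorem IsBlockFamily.isDiamCover_cthickening {r w : ℝ≥0∞} {ρ : ℝ≥0} {𝓖 : Finset (Finset ι)}
    (h𝓖 : IsBlockFamily U r 𝓖) (hw : ∑' i, Metric.ediam (U i) ≤ w)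
    (hF : F ⊆ ⋃ G ∈ 𝓖, Metric.cthickening ρ (⋃ i ∈ G, U i)) :
    IsDiamCover (r + 2 * ρ) (w + 𝓖.card * (2 * ρ))
      (fun G : 𝓖 => Metric.cthickening ρ (⋃ i ∈ G.1, U i)) F := by
  have hdiam (G : 𝓖) : Metric.ediam (Metric.cthickening ρ (⋃ i ∈ G.1, U i)) ≤
      ∑ i ∈ G.1, Metric.ediam (U i) + 2 * ρ :=
    (Metric.ediam_cthickening_le ρ).trans
      (add_le_add_left (h𝓖.isBlock G G.2).ediam_biUnion_le _)
  refine ⟨hF.trans_eq (Set.biUnion_eq_iUnion _ _),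
    fun G => (hdiam G).trans (add_le_add_left (h𝓖.isBlock G G.2).sum_ediam_le _), ?_⟩
  rw [tsum_fintype]
  calc ∑ G : 𝓖, Metric.ediam (Metric.cthickening ρ (⋃ i ∈ G.1, U i))
      ≤ ∑ G : 𝓖, (∑ i ∈ G.1, Metric.ediam (U i) + 2 * ρ) := Finset.sum_le_sum fun G _ => hdiam G
    _ = ∑ G ∈ 𝓖, ∑ i ∈ G, Metric.ediam (U i) + 𝓖.card * (2 * ρ) := by
      rw [Finset.sum_coe_sort 𝓖 fun G => ∑ i ∈ G, Metric.ediam (U i) + 2 * (ρ : ℝ≥0∞),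
        Finset.sum_add_distrib, Finset.sum_const, nsmul_eq_mul]
    _ ≤ w + 𝓖.card * (2 * ρ) := add_le_add_left (h𝓖.sum_sum_ediam_le_tsum.trans hw) _

theorem exists_isDiamCover_of_isCover_isPreconnected (hB : IsPreconnected B)
    (hU : ∀ i, IsOpen (U i)) {c : ℝ≥0} {w : ℝ≥0∞} (hBU : IsDiamCover c w U B) {K : ℕ}
    (hK : w < ∑ j ∈ Finset.range K, ((c / j : ℝ≥0) : ℝ≥0∞)) (hF : Metric.IsCover (c / K) F B) :
    ∃ S : Fin K → Set X, IsDiamCover (6 * c) (w + 4 * c) S F := by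
  have div_le (j : ℕ) : c / j ≤ c := by
    rcases j.eq_zero_or_pos with rfl | hj
    · simp
    · exact div_le_self c.2 (Nat.one_le_cast.2 hj)
  have mul_div_le (j : ℕ) : j * (c / j) ≤ c :=
    (mul_div_left_comm _ _ _).trans_le (mul_le_of_le_one_right c.2 (div_self_le_one _))
  -- The first block is unrestricted: its threshold is `c / 0 = 0`.
  obtain ⟨𝓖, h𝓖, hcard, hcov⟩ := exists_isBlockFamily_isCover hB hU hBU.subset_iUnion hBU.ediam_le
    (t := fun j => c / j) (by simp) div_le (hBU.tsum_ediam_le.trans_lt hK)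
  set ρ : ℝ≥0 := c / K + c / 𝓖.card with hρ
  have hsub : F ⊆ ⋃ G ∈ 𝓖, Metric.cthickening ρ (⋃ i ∈ G, U i) := by
    intro x hx
    obtain ⟨y, hy, hxy⟩ := hF hx
    obtain ⟨z, hz, hyz⟩ := hcov hy
    obtain ⟨G, hG, hzG⟩ := Set.mem_iUnion₂.1 hz
    refine Set.mem_biUnion hG (Metric.mem_cthickening_of_edist_le x z _ _ hzG ?_)
    rw [ENNReal.ofReal_coe_nnreal, hρ, ENNReal.coe_add]
    exact (edist_triangle x y z).trans (add_le_add hxy hyz)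
  have hcρ : 2 * c + 2 * ρ ≤ 6 * c := by
    calc 2 * c + 2 * ρ ≤ 2 * c + 2 * (c + c) := by
          gcongr; exact add_le_add (div_le _) (div_le _)
      _ = 6 * c := by ring
  have hcardρ : 𝓖.card * (2 * ρ) ≤ 4 * c := by
    calc 𝓖.card * (2 * ρ) = 2 * (𝓖.card * (c / K) + 𝓖.card * (c / 𝓖.card)) := by rw [hρ]; ring
      _ ≤ 2 * (K * (c / K) + 𝓖.card * (c / 𝓖.card)) := by gcongr
      _ ≤ 2 * (c + c) := by gcongr <;> exact mul_div_le _
      _ = 4 * c := by ring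
  obtain ⟨f⟩ : Nonempty (𝓖 ↪ Fin K) :=
    Function.Embedding.nonempty_of_card_le (by simpa using hcard.le)
  exact ⟨_, ((h𝓖.isDiamCover_cthickening hBU.tsum_ediam_le hsub).extend f.injective).mono
    (by exact_mod_cast hcρ) (add_le_add_right (by exact_mod_cast hcardρ) w)⟩

theorem exists_lt_sum_range_div {c : ℝ≥0} (hc : 0 < c) (w : ℝ≥0) :
    ∃ K : ℕ, w < ∑ j ∈ Finset.range K, c / j := by
  have hdiv : ¬ Summable fun j : ℕ => c / (j : ℝ≥0) := by
    simpa only [← NNReal.summable_coe, div_eq_mul_inv, NNReal.coe_mul, NNReal.coe_inv,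
      NNReal.coe_natCast, summable_mul_left_iff (NNReal.coe_ne_zero.2 hc.ne')]
      using Real.not_summable_natCast_inv
  exact ((NNReal.not_summable_iff_tendsto_nat_atTop.1 hdiv).eventually_gt_atTop w).exists

end NearConnected

section OuterLinear

variable {X : Type*} [MetricSpace X] {A B : Set X}

theorem outerLinearPre_le_of_isDiamCover {δ : ℝ} {s : ℝ≥0∞} {S : ℕ → Set X}
    (h : IsDiamCover (ENNReal.ofReal δ) s S A) : outerLinearPre δ A ≤ s :=
  (iInf₂_le_of_le S h.subset_iUnion (iInf_le _ h.ediam_le)).trans h.tsum_ediam_le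

theorem exists_isDiamCover_of_outerLinearPre_lt {δ : ℝ} {s : ℝ≥0∞} (h : outerLinearPre δ A < s) :
    ∃ S : ℕ → Set X, IsDiamCover (ENNReal.ofReal δ) s S A := by
  simp only [outerLinearPre, iInf_lt_iff] at h
  obtain ⟨S, hAS, hdiam, hsum⟩ := h
  exact ⟨S, hAS, hdiam, hsum.le⟩

theorem exists_isOpen_isDiamCover {α c : ℝ≥0} (hc : 0 < c) (hB : outerLinear B ≤ α) :
    ∃ U : ℕ → Set X, (∀ i, IsOpen (U i)) ∧ IsDiamCover c (α + c) U B := by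
  have hc2 : 0 < c / 2 := half_pos hc
  have hlt : outerLinearPre (c / 2 : ℝ≥0) B < α + (c / 2 : ℝ≥0) :=
    ((le_iSup₂ (f := fun δ (_ : 0 < δ) => outerLinearPre δ B) ((c / 2 : ℝ≥0) : ℝ) hc2).trans
      hB).trans_lt (ENNReal.lt_add_right ENNReal.coe_ne_top (ENNReal.coe_ne_zero.2 hc2.ne'))
  obtain ⟨V, hV⟩ := exists_isDiamCover_of_outerLinearPre_lt hlt
  obtain ⟨U, hU, hcov⟩ := hV.exists_isOpen hc2
  have hadd : ((c / 2 : ℝ≥0) : ℝ≥0∞) + (c / 2 : ℝ≥0) = c := by exact_mod_cast add_halves c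
  exact ⟨U, hU, by simpa only [ENNReal.ofReal_coe_nnreal, add_assoc, hadd] using hcov⟩

variable (X) in
/-- Uniformity of `N` and `η` in `B` is the point: it comes from the divergence of the harmonic
series. -/
theorem exists_forall_isPreconnected_exists_isDiamCover (α : ℝ≥0) {κ : ℝ≥0} (hκ : 0 < κ) :
    ∃ (N : ℕ) (η : ℝ≥0), 0 < η ∧ ∀ B : Set X, IsPreconnected B → outerLinear B ≤ α →
      ∀ F : Set X, Metric.IsCover η F B → ∃ S : Fin N → Set X, IsDiamCover κ (α + κ) S F := by
  obtain ⟨c, hc, rfl⟩ : ∃ c : ℝ≥0, 0 < c ∧ 6 * c = κ :=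
    ⟨κ / 6, by positivity, mul_div_cancel₀ κ (by norm_num)⟩
  obtain ⟨K, hK⟩ := exists_lt_sum_range_div hc (α + c)
  have hK0 : 0 < K := Nat.pos_of_ne_zero (by rintro rfl; simp at hK)
  refine ⟨K, c / K, by positivity, fun B hB hBα F hF => ?_⟩
  obtain ⟨U, hU, hcov⟩ := exists_isOpen_isDiamCover hc hBα
  obtain ⟨S, hS⟩ :=
    exists_isDiamCover_of_isCover_isPreconnected hB hU hcov (by exact_mod_cast hK) hF
  have hsum : α + c + 4 * c ≤ α + 6 * c := by
    calc α + c + 4 * c = α + 5 * c := by ring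
      _ ≤ α + 6 * c := by gcongr; norm_num
  exact ⟨S, hS.mono (by simp) (by exact_mod_cast hsum)⟩

theorem exists_finset_forall_not_isDiamCover {a : ℝ≥0} (ha : a < outerLinear A) :
    ∃ κ : ℝ≥0, 0 < κ ∧ ∀ N : ℕ, ∃ F : Finset X, (F : Set X) ⊆ A ∧
      ∀ S : Fin N → Set X, ¬ IsDiamCover κ (a + κ) S F := by
  simp only [outerLinear, lt_iSup_iff] at ha
  obtain ⟨δ, hδ, haδ⟩ := ha
  obtain ⟨ε, hε, haε⟩ := ENNReal.lt_iff_exists_add_pos_lt.1 haδ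
  refine ⟨min ε δ.toNNReal, lt_min hε (Real.toNNReal_pos.2 hδ), fun N => ?_⟩
  by_contra! hcov
  obtain ⟨S, hS⟩ := exists_isDiamCover_of_forall_finset hcov
  refine haε.not_ge (outerLinearPre_le_of_isDiamCover
    ((hS.extend Fin.val_injective).mono (ENNReal.coe_le_coe.2 (min_le_right _ _)) ?_))
  exact add_le_add_right (ENNReal.coe_le_coe.2 (min_le_left _ _)) _

theorem exists_finite_isOpen_hits_forall_lt_outerLinear {a : ℝ≥0∞} (ha : a < outerLinear A) :
    ∃ 𝓤 : Set (Set X), 𝓤.Finite ∧ (∀ U ∈ 𝓤, IsOpen U) ∧ Hits A 𝓤 ∧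
      ∀ B : Set X, IsPreconnected B → Hits B 𝓤 → a < outerLinear B := by
  lift a to ℝ≥0 using ha.ne_top
  obtain ⟨κ, hκ, hfin⟩ := exists_finset_forall_not_isDiamCover ha
  obtain ⟨N, η, hη, hnear⟩ := exists_forall_isPreconnected_exists_isDiamCover X a hκ
  obtain ⟨F, hFA, hF⟩ := hfin N
  refine ⟨(fun x => Metric.ball x η) '' F, F.finite_toSet.image _,
    Set.forall_mem_image.2 fun x _ => Metric.isOpen_ball,
    Set.forall_mem_image.2 fun x hx => ⟨x, hFA hx, Metric.mem_ball_self hη⟩, fun B hB hBF => ?_⟩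
  by_contra! hBa
  have hcov : Metric.IsCover η (F : Set X) B := fun x hx => by
    obtain ⟨b, hbB, hbx⟩ := hBF _ ⟨x, hx, rfl⟩
    have hlt : b ∈ Metric.eball x η := by rwa [Metric.eball_coe]
    exact ⟨b, hbB, (Metric.mem_eball'.1 hlt).le⟩
  obtain ⟨S, hS⟩ := hnear B hB hBa F hcov
  exact hF S hS

theorem exists_finite_isOpen_hits_forall_lt_outerLinear_add (hA : outerLinear A ≠ ∞) {ε : ℝ≥0∞}
    (hε : 0 < ε) (hε' : ε ≠ ∞) :
    ∃ 𝓤 : Set (Set X), 𝓤.Finite ∧ (∀ U ∈ 𝓤, IsOpen U) ∧ Hits A 𝓤 ∧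
      ∀ B : Set X, IsPreconnected B → Hits B 𝓤 → outerLinear A < outerLinear B + ε := by
  rcases eq_or_ne (outerLinear A) 0 with h0 | h0
  · exact ⟨∅, Set.finite_empty, by simp, by simp [Hits], fun B _ _ => by
      rw [h0]; exact hε.trans_le le_add_self⟩
  · obtain ⟨𝓤, hfin, hopen, hA𝓤, hlt⟩ :=
      exists_finite_isOpen_hits_forall_lt_outerLinear (ENNReal.sub_lt_self hA h0 hε.ne')
    exact ⟨𝓤, hfin, hopen, hA𝓤, fun B hB hB𝓤 => le_tsub_add.trans_lt
      ((ENNReal.add_lt_add_iff_right hε').2 (hlt B hB hB𝓤))⟩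

theorem outerLinear_le_of_forall_exists_hits {α : ℝ≥0∞}
    (h : ∀ 𝓤 : Set (Set X), 𝓤.Finite → (∀ U ∈ 𝓤, IsOpen U) → Hits A 𝓤 →
      ∃ C : Set X, IsPreconnected C ∧ Hits C 𝓤 ∧ outerLinear C ≤ α) :
    outerLinear A ≤ α := by
  by_contra! hlt
  obtain ⟨𝓤, hfin, hopen, hA, hB⟩ := exists_finite_isOpen_hits_forall_lt_outerLinear hlt
  obtain ⟨C, hC, hC𝓤, hCα⟩ := h 𝓤 hfin hopen hA
  exact (hB C hC hC𝓤).not_ge hCα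

end OuterLinear

section LowerVietoris

attribute [local instance] lowerVietoris

variable {X Λ : Type*}

theorem tendsto_lowerVietoris_iff [TopologicalSpace X] {l : Filter Λ} {C : Λ → Set X} {A : Set X} :
    Tendsto C l (𝓝 A) ↔
      ∀ U, IsOpen U → (A ∩ U).Nonempty → ∀ᶠ i in l, (C i ∩ U).Nonempty := by
  refine TopologicalSpace.tendsto_nhds_generateFrom_iff.trans ⟨fun h U hU hAU => ?_, ?_⟩
  · exact h _ ⟨U, hU, rfl⟩ hAU
  · rintro h _ ⟨U, hU, rfl⟩ hAU
    exact h U hU hAU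

theorem eventually_hits [TopologicalSpace X] {A : Set X} {𝓤 : Set (Set X)} (hfin : 𝓤.Finite)
    (hopen : ∀ U ∈ 𝓤, IsOpen U) (hA : Hits A 𝓤) : ∀ᶠ B in 𝓝 A, Hits B 𝓤 :=
  (eventually_all_finite hfin).2 fun U hU =>
    tendsto_lowerVietoris_iff.1 tendsto_id U (hopen U hU) (hA U hU)

variable [MetricSpace X] {A : Set X}

theorem tendsto_lowerVietoris_of_tendsto_excess {l : Filter Λ} {C : Λ → Set X}
    (h : Tendsto (fun i => excess A (C i)) l (𝓝 0)) : Tendsto C l (𝓝 A) := by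
  refine tendsto_lowerVietoris_iff.2 fun U hU ⟨a, haA, haU⟩ => ?_
  obtain ⟨r, hr, hrU⟩ := EMetric.isOpen_iff.1 hU a haU
  filter_upwards [h.eventually_lt_const hr] with i hi
  have hlt : Metric.infEDist a (C i) < r :=
    (le_iSup₂ (f := fun a (_ : a ∈ A) => Metric.infEDist a (C i)) a haA).trans_lt hi
  obtain ⟨b, hb, hab⟩ := Metric.infEDist_lt_iff.1 hlt
  exact ⟨b, hb, hrU (Metric.mem_eball'.2 hab)⟩

theorem exists_forall_excess_lt_of_eventually {P : Set X → Prop} (h : ∀ᶠ B in 𝓝 A, P B) :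
    ∃ δ : ℝ, 0 < δ ∧ ∀ B, excess A B < ENNReal.ofReal δ → P B := by
  have hexcess : ∀ᶠ B in comap (excess A) (𝓝 0), P B :=
    tendsto_lowerVietoris_of_tendsto_excess tendsto_comap h
  obtain ⟨r, hr, hP⟩ := (ENNReal.nhds_zero_basis.comap (excess A)).eventually_iff.1 hexcess
  obtain ⟨δ, hδ, hδr⟩ := ENNReal.lt_iff_exists_nnreal_btwn.1 hr
  exact ⟨δ, ENNReal.coe_pos.1 hδ, fun B hB =>
    hP (hB.trans (ENNReal.ofReal_coe_nnreal.trans_lt hδr))⟩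

theorem tendsto_lowerLimit [Preorder Λ] (C : Λ → Set X) : Tendsto C atTop (𝓝 (lowerLimit C)) := by
  refine tendsto_lowerVietoris_iff.2 fun U hU ⟨x, hx, hxU⟩ => ?_
  obtain ⟨r, hr, hrU⟩ := Metric.isOpen_iff.1 hU x hxU
  obtain ⟨l₀, hl₀⟩ := hx r hr
  filter_upwards [eventually_ge_atTop l₀] with l hl
  exact (hl₀ l hl).mono (Set.inter_subset_inter_right _ hrU)

theorem lowerSemicontinuousWithinAt_outerLinear (A : Set X) :
    LowerSemicontinuousWithinAt outerLinear {C : Set X | IsPreconnected C} A := by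
  intro a ha
  obtain ⟨𝓤, hfin, hopen, hA, hlt⟩ := exists_finite_isOpen_hits_forall_lt_outerLinear ha
  filter_upwards [nhdsWithin_le_nhds (eventually_hits hfin hopen hA), self_mem_nhdsWithin]
    with C hC𝓤 hC using hlt C hC hC𝓤

theorem outerLinear_le_liminf {l : Filter Λ} {C : Λ → Set X} (hC : ∀ᶠ i in l, IsPreconnected (C i))
    (h : Tendsto C l (𝓝 A)) : outerLinear A ≤ liminf (fun i => outerLinear (C i)) l :=
  (lowerSemicontinuousWithinAt_outerLinear A).le_liminf.trans
    (liminf_le_liminf_of_le (tendsto_nhdsWithin_iff.2 ⟨h, hC⟩))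

end LowerVietoris

end Golab

/-- Strongest form of Gołąb's theorem, the resulting lower semicontinuity for the lower Vietoris
topology, and the Gołąb, Frink, Bognár and Fremlin versions. Connected subsets are `IsPreconnected`
sets, so that the empty set is allowed as well; this only strengthens each part. -/
theorem mainTheorem2 (X : Type*) [MetricSpace X] :
    -- finite case of the main statement
    (∀ A : Set X, Golab.outerLinear A < ∞ → ∀ ε : ℝ, 0 < ε →
      ∃ 𝓤 : Set (Set X), 𝓤.Finite ∧ (∀ U ∈ 𝓤, IsOpen U) ∧ Golab.Hits A 𝓤 ∧
        ∀ B : Set X, IsPreconnected B → Golab.Hits B 𝓤 →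
          Golab.outerLinear A < Golab.outerLinear B + ENNReal.ofReal ε) ∧
    -- infinite case of the main statement
    (∀ A : Set X, Golab.outerLinear A = ∞ → ∀ M : ℝ, 0 < M →
      ∃ 𝓤 : Set (Set X), 𝓤.Finite ∧ (∀ U ∈ 𝓤, IsOpen U) ∧ Golab.Hits A 𝓤 ∧
        ∀ B : Set X, IsPreconnected B → Golab.Hits B 𝓤 →
          ENNReal.ofReal M < Golab.outerLinear B) ∧
    -- lower semicontinuity on connected sets for the lower Vietoris topology
    (@LowerSemicontinuousOn (Set X) ℝ≥0∞ (Golab.lowerVietoris X) _ Golab.outerLinear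
      {C : Set X | IsPreconnected C}) ∧
    -- Gołąb's version
    (∀ (A : Set X) (C : ℕ → Set X), (∀ n, IsPreconnected (C n)) →
      Tendsto (fun n => Golab.excess A (C n)) atTop (𝓝 0) →
      Golab.outerLinear A ≤ liminf (fun n => Golab.outerLinear (C n)) atTop) ∧
    -- Frink's version, finite case
    (∀ A : Set X, Golab.outerLinear A < ∞ → ∀ ε : ℝ, 0 < ε →
      ∃ δ : ℝ, 0 < δ ∧ ∀ B : Set X, IsPreconnected B → Golab.excess A B < ENNReal.ofReal δ →
        Golab.outerLinear A < Golab.outerLinear B + ENNReal.ofReal ε) ∧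
    -- Frink's version, infinite case
    (∀ A : Set X, Golab.outerLinear A = ∞ → ∀ M : ℝ, 0 < M →
      ∃ δ : ℝ, 0 < δ ∧ ∀ B : Set X, IsPreconnected B → Golab.excess A B < ENNReal.ofReal δ →
        ENNReal.ofReal M < Golab.outerLinear B) ∧
    -- Bognár's version, for nets
    (∀ (Λ : Type*) [Preorder Λ] [IsDirectedOrder Λ] [Nonempty Λ] (C : Λ → Set X),
      (∀ l, IsPreconnected (C l)) →
      Golab.outerLinear (Golab.lowerLimit C) ≤
        liminf (fun l => Golab.outerLinear (C l)) atTop) ∧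
    -- Fremlin's version
    (∀ (A : Set X) (α : ℝ≥0),
      (∀ 𝓤 : Set (Set X), 𝓤.Finite → (∀ U ∈ 𝓤, IsOpen U) → Golab.Hits A 𝓤 →
        ∃ C : Set X, IsPreconnected C ∧ Golab.Hits C 𝓤 ∧ Golab.outerLinear C ≤ α) →
      Golab.outerLinear A ≤ α) := by
  have finite_case (A : Set X) (hA : Golab.outerLinear A < ∞) (ε : ℝ) (hε : 0 < ε) :=
    Golab.exists_finite_isOpen_hits_forall_lt_outerLinear_add hA.ne (ENNReal.ofReal_pos.2 hε)
      ENNReal.ofReal_ne_top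
  have infinite_case (A : Set X) (hA : Golab.outerLinear A = ∞) (M : ℝ) :=
    Golab.exists_finite_isOpen_hits_forall_lt_outerLinear
      (hA ▸ ENNReal.ofReal_lt_top : ENNReal.ofReal M < Golab.outerLinear A)
  refine ⟨finite_case, fun A hA M _ => infinite_case A hA M,
    fun A _ => Golab.lowerSemicontinuousWithinAt_outerLinear A,
    fun A C hC hlim => Golab.outerLinear_le_liminf (.of_forall hC)
      (Golab.tendsto_lowerVietoris_of_tendsto_excess hlim),
    fun A hA ε hε => ?_, fun A hA M _ => ?_,
    fun Λ _ _ _ C hC => Golab.outerLinear_le_liminf (.of_forall hC) (Golab.tendsto_lowerLimit C),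
    fun A α h => Golab.outerLinear_le_of_forall_exists_hits h⟩
  · obtain ⟨𝓤, hfin, hopen, hA𝓤, hlt⟩ := finite_case A hA ε hε
    obtain ⟨δ, hδ, hits⟩ :=
      Golab.exists_forall_excess_lt_of_eventually (Golab.eventually_hits hfin hopen hA𝓤)
    exact ⟨δ, hδ, fun B hB hAB => hlt B hB (hits B hAB)⟩
  · obtain ⟨𝓤, hfin, hopen, hA𝓤, hlt⟩ := infinite_case A hA M
    obtain ⟨δ, hδ, hits⟩ :=
      Golab.exists_forall_excess_lt_of_eventually (Golab.eventually_hits hfin hopen hA𝓤)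
    exact ⟨δ, hδ, fun B hB hAB => hlt B hB (hits B hAB)⟩
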